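/- Let $q\ge 2$ be an integer and consider three sites $1,2,3$, each carrying a qudit of local dimension $q$. For a matrix $A$ write $A^{\otimes 2,2}=A^{\otimes 2}\otimes\overline{A}^{\otimes 2}$, where $\overline A$ is the entrywise complex conjugate. For two distinct sites $i,j$ let $$(P_H)_{i,j}=\int_{\mathcal U(q^2)} U_{i,j}^{\otimes 2,2}\,d\mu_{\rm Haar}(U),\qquad h_{i,j}=\mathbb I-(P_H)_{i,j}\otimes\mathbb I_{[3]\setminus\{i,j\}},$$ where $\mu_{\rm Haar}$ is the Haar probability measure on the unitary group $\mathcal U(q^2)$ of the two-site space $\mathbb C^q\otimes\mathbb C^q$, $U_{i,j}$ denotes $U$ acting on the sites $i,j$, and $\mathbb I_{[3]\setminus\{i,j\}}$ is the identity on the four copies of the third site; thus $h_{i,j}$ acts on four copies of $(\mathbb C^q)^{\otimes 3}$. The random-quantum-circuit Hamiltonian of the complete graph on three sites for the second moment ($k=2$) is the Hermitian operator $$H(\mathrm{CG},3,2)=h_{1,2}+h_{2,3}+h_{3,1}.$$ Its spectral gap $\Delta(\mathrm{CG},3,2)$, that is, the difference between its two smallest distinct eigenvalues, equals $$\Delta(\mathrm{CG},3,2)=2\left(1-\frac{q}{q^2+1}\right).$$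 In particular, for qubits ($q=2$) the gap is $\Delta(\mathrm{CG},3,2)=6/5$. -/

import Mathlib

open MeasureTheory

namespace RQC

section Haar

variable (ι : Type*) [Fintype ι] [DecidableEq ι]

/-- The unitary group `𝒰(d)`, with `d` the number of elements of `ι`, is compact. -/
instance instCompactSpaceUnitaryGroup : CompactSpace (Matrix.unitaryGroup ι ℂ) := by
  refine isCompact_iff_compactSpace.mp ?_
  have hcl : IsClosed (Matrix.unitaryGroup ι ℂ : Set (Matrix ι ι ℂ)) := isClosed_unitary
  have hK : IsCompact (Set.pi Set.univ fun _ : ι => Set.pi Set.univ fun _ : ι =>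
      Metric.closedBall (0 : ℂ) 1) :=
    isCompact_univ_pi fun _ => isCompact_univ_pi fun _ => isCompact_closedBall 0 1
  refine hK.of_isClosed_subset hcl fun U hU i _ j _ => ?_
  simpa using entry_norm_bound_of_unitary hU i j

/-- The Borel `σ`-algebra of the unitary group. -/
noncomputable instance instMeasurableSpaceUnitaryGroup : MeasurableSpace (Matrix.unitaryGroup ι ℂ) :=
  borel _

instance instBorelSpaceUnitaryGroup : BorelSpace (Matrix.unitaryGroup ι ℂ) := ⟨rfl⟩

/-- The Haar probability measure on the unitary group. -/
noncomputable def haarUnitary : Measure (Matrix.unitaryGroup ι ℂ) :=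
  Measure.haarMeasure (⊤ : TopologicalSpace.PositiveCompacts (Matrix.unitaryGroup ι ℂ))

end Haar

section Hamiltonian

variable {V : Type*} [Fintype V] [DecidableEq V] {q : ℕ}

/-- Index set of the computational basis of `(ℂ^q)^{⊗ S}`, the Hilbert space of the qudits
(of local dimension `q`) at the sites in `S`. -/
abbrev SiteConfig (q : ℕ) (S : Finset V) : Type _ := {v : V // v ∈ S} → Fin q

/-- The operator `A_S ⊗ 𝕀_{V \ S}` on `(ℂ^q)^{⊗ V}`, for an operator `A` on `(ℂ^q)^{⊗ S}`. -/
def extendOp (S : Finset V) (A : Matrix (SiteConfig q S) (SiteConfig q S) ℂ) :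
    Matrix (V → Fin q) (V → Fin q) ℂ :=
  Matrix.of fun x y =>
    if ∀ v, v ∉ S → x v = y v then A (fun v => x v) (fun v => y v) else 0

/-- Basis index set of `2k` copies of a space with basis index set `α`: the first `k` copies are
those acted on by `A`, the last `k` are those acted on by the complex conjugate of `A`. -/
abbrev Copies (k : ℕ) (α : Type*) : Type _ := (Fin k → α) × (Fin k → α)

/-- `A^{⊗ k,k} = A^{⊗ k} ⊗ (conj A)^{⊗ k}`. -/
def tensorKK {α : Type*} (k : ℕ) (A : Matrix α α ℂ) : Matrix (Copies k α) (Copies k α) ℂ :=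
  Matrix.of fun x y => (∏ a, A (x.1 a) (y.1 a)) * ∏ a, star (A (x.2 a) (y.2 a))

/-- The Haar moment operator `∫ U_S^{⊗ k,k} ⊗ 𝕀_{V \ S}^{⊗ k,k} dμ_Haar(U)`, where `U` runs over
the unitary group of `(ℂ^q)^{⊗ S}`; the integral of a matrix is taken entry by entry. -/
noncomputable def haarMoment (q k : ℕ) (S : Finset V) :
    Matrix (Copies k (V → Fin q)) (Copies k (V → Fin q)) ℂ :=
  Matrix.of fun x y =>
    ∫ U : Matrix.unitaryGroup (SiteConfig q S) ℂ,
      tensorKK k (extendOp S (U : Matrix (SiteConfig q S) (SiteConfig q S) ℂ)) x y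
        ∂(haarUnitary (SiteConfig q S))

/-- The local term `h_S = 𝕀 - (P_H)_S ⊗ 𝕀_{V \ S}`. -/
noncomputable def localTerm (q k : ℕ) (S : Finset V) :
    Matrix (Copies k (V → Fin q)) (Copies k (V → Fin q)) ℂ :=
  1 - haarMoment q k S

/-- The random-quantum-circuit Hamiltonian `H(G, n, k) = ∑_{(i,j) ∈ E} h_{i,j}` of the graph `G`
on the `n` sites `V`, with local dimension `q`. -/
noncomputable def hamiltonian (G : SimpleGraph V) [DecidableRel G.Adj] (q k : ℕ) :
    Matrix (Copies k (V → Fin q)) (Copies k (V → Fin q)) ℂ :=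
  ∑ e ∈ G.edgeFinset, localTerm q k e.toFinset

end Hamiltonian

/-- `H` is Hermitian and has spectral gap `Δ`: the difference between the smallest eigenvalue
(the ground energy) and the second smallest distinct eigenvalue is `Δ`. -/
def HasSpectralGap {α : Type*} [Fintype α] [DecidableEq α] (H : Matrix α α ℂ) (Δ : ℝ) : Prop :=
  H.IsHermitian ∧ ∃ E₀ E₁ : ℝ, IsLeast (spectrum ℝ H) E₀ ∧
    IsLeast (spectrum ℝ H \ {E₀}) E₁ ∧ Δ = E₁ - E₀

end RQC

namespace RQC

open Matrix

/-! Write H = 3 - Q, with Q = `pairMomentSum q` the sum of the three pair moment operators. The two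
lowest eigenvalues of H correspond to the two largest of Q.

For k = 2 the vectors invariant under all U ⊗ U ⊗ Ū ⊗ Ū are spanned by the two pairing vectors
(`exists_eq_of_tensorKK_two_mulVec_eq`). Hence each pair operator is a Hermitian projection that
puts a common pairing on its two sites, and any two of them together cover all three sites. If Q v =
μ v with μ ≠ 0, 1, applying one projection P to this equation expresses (μ - 1) P v through products
of two different projections. So v lies in the span of the eight vectors `permVec q σ`
(`mem_span_permVec_of_pairMomentSum_mulVec`).

On that span Q is explicit: with t = q/(q²+1), a projection fixes equal pairings and sends unequal
ones to t times the sum of the two equalized vectors. The two constant σ have eigenvalue 3. Modulo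
these, Q - 1 exchanges the two triples with one deviating site through t(J - I), where J is the
all-ones 3×3 matrix. As J - I has eigenvalues 2, -1, -1, the remaining candidates are 1 ± 2t and 1 ±
t. Since 0 < t < 1/2, the second largest eigenvalue of Q is 1 + 2t, attained by an explicit
symmetric vector, and the gap is 3 - (1 + 2t) = 2(1 - t). -/

theorem tensorKK_mul {α : Type*} [Fintype α] {k : ℕ} (A B : Matrix α α ℂ) :
    tensorKK k (A * B) = tensorKK k A * tensorKK k B := by
  ext x y
  simp only [tensorKK, Matrix.of_apply, Matrix.mul_apply, Fintype.sum_prod_type, star_sum,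
    star_mul', Finset.prod_univ_sum, Fintype.piFinset_univ, Finset.sum_mul_sum,
    Finset.prod_mul_distrib]
  refine Finset.sum_congr rfl fun _ _ => Finset.sum_congr rfl fun _ _ => ?_
  ring

theorem conjTranspose_tensorKK {α : Type*} {k : ℕ} (A : Matrix α α ℂ) :
    (tensorKK k A)ᴴ = tensorKK k Aᴴ := by
  ext x y
  simp [tensorKK, Matrix.conjTranspose_apply]

/-! ### Haar averages and the pairing vectors they fix -/

section Moment

variable {α : Type*} [Fintype α] [DecidableEq α] {k : ℕ}

instance instIsProbabilityMeasureHaarUnitary : IsProbabilityMeasure (haarUnitary α) :=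
  ⟨Measure.haarMeasure_self (K₀ := ⊤)⟩

instance instIsHaarMeasureHaarUnitary : (haarUnitary α).IsHaarMeasure := by
  unfold haarUnitary; infer_instance

theorem continuous_tensorKK_apply (x y : Copies k α) :
    Continuous fun U : Matrix.unitaryGroup α ℂ => tensorKK k (U : Matrix α α ℂ) x y := by
  have h : ∀ i j : α, Continuous fun U : Matrix.unitaryGroup α ℂ => (U : Matrix α α ℂ) i j :=
    fun i j => (continuous_subtype_val.matrix_elem i j)
  simp only [tensorKK, Matrix.of_apply]
  exact (continuous_finsetProd _ fun a _ => h _ _).mul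
    (continuous_finsetProd _ fun a _ => (h _ _).star)

theorem integrable_tensorKK_apply (x y : Copies k α) :
    Integrable (fun U : Matrix.unitaryGroup α ℂ => tensorKK k (U : Matrix α α ℂ) x y)
      (haarUnitary α) :=
  (continuous_tensorKK_apply x y).integrable_of_hasCompactSupport
    (HasCompactSupport.of_compactSpace _)

/-- The vector of `2k` copies which pairs the conjugate copy `p a` with the copy `a`. -/
def pairVec {β : Type*} [DecidableEq β] (p : Equiv.Perm (Fin k)) (x : Copies k β) : ℂ :=
  if x.1 = x.2 ∘ p then 1 else 0

/-- The Haar moment operator `∫ U^{⊗ k,k} dμ_Haar(U)` of the whole space. -/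
noncomputable def fullMoment (k : ℕ) (α : Type*) [Fintype α] [DecidableEq α] :
    Matrix (Copies k α) (Copies k α) ℂ :=
  Matrix.of fun x y => ∫ U : Matrix.unitaryGroup α ℂ,
    tensorKK k (U : Matrix α α ℂ) x y ∂(haarUnitary α)

/-- Left invariance of Haar measure, entry by entry: every column of the moment operator is an
invariant vector. -/
theorem tensorKK_mul_fullMoment (V : Matrix.unitaryGroup α ℂ) :
    tensorKK k (V : Matrix α α ℂ) * fullMoment k α = fullMoment k α := by
  ext x y
  simp only [Matrix.mul_apply, fullMoment, Matrix.of_apply, ← integral_const_mul]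
  rw [← integral_finsetSum _ fun z _ => (integrable_tensorKK_apply z y).const_mul _,
    ← integral_mul_left_eq_self (fun U : Matrix.unitaryGroup α ℂ =>
      tensorKK k (U : Matrix α α ℂ) x y) V]
  refine integral_congr_ae (.of_forall fun U => ?_)
  simp [tensorKK_mul, Matrix.mul_apply]

/-- Averaging the identity (U⁻¹)^{⊗ k,k} P = P over U gives Pᴴ P = P, and the left side is
Hermitian. Only left invariance is needed, not invariance under inversion. -/
theorem isHermitian_fullMoment : (fullMoment k α).IsHermitian := by
  have h : (fullMoment k α)ᴴ * fullMoment k α = fullMoment k α := by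
    ext x y
    have hU : ∀ U : Matrix.unitaryGroup α ℂ,
        ∑ z, star (tensorKK k (U : Matrix α α ℂ) z x) * fullMoment k α z y
          = fullMoment k α x y := fun U => by
      have h1 := congrFun (congrFun (tensorKK_mul_fullMoment (k := k) U⁻¹) x) y
      rw [Matrix.mul_apply] at h1
      rw [← h1]
      refine Finset.sum_congr rfl fun z _ => ?_
      rw [← Matrix.conjTranspose_apply, conjTranspose_tensorKK]
      rfl
    rw [Matrix.mul_apply]
    simp only [Matrix.conjTranspose_apply]
    have h2 : ∀ z, star (fullMoment k α z x) = ∫ U : Matrix.unitaryGroup α ℂ,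
        star (tensorKK k (U : Matrix α α ℂ) z x) ∂(haarUnitary α) := fun z =>
      (integral_conj (𝕜 := ℂ)).symm
    simp only [h2, ← integral_mul_const]
    rw [← integral_finsetSum]
    · simp only [hU]
      simp
    · intro z _
      exact (((continuous_tensorKK_apply z x).star).mul continuous_const
        ).integrable_of_hasCompactSupport (HasCompactSupport.of_compactSpace _)
  rw [← h]
  exact Matrix.isHermitian_conjTranspose_mul_self _

/-- After reindexing the copies by `p`, each factor U meets its paired conjugate, and U Uᴴ = 1 is
applied once per pair. -/
theorem tensorKK_mulVec_pairVec (U : Matrix.unitaryGroup α ℂ) (p : Equiv.Perm (Fin k)) :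
    tensorKK k (U : Matrix α α ℂ) *ᵥ pairVec p = pairVec p := by
  ext x
  have hU : ∀ i j, ∑ c, (U : Matrix α α ℂ) i c * star ((U : Matrix α α ℂ) j c)
      = if i = j then 1 else 0 := fun i j => by
    have := congrFun (congrFun (Matrix.mem_unitaryGroup_iff.mp U.2) i) j
    simpa [Matrix.mul_apply, Matrix.one_apply, Matrix.star_apply] using this
  simp only [Matrix.mulVec, dotProduct, tensorKK, Matrix.of_apply, pairVec, mul_ite, mul_one,
    mul_zero, Fintype.sum_prod_type]
  rw [Finset.sum_comm]
  simp only [Finset.sum_ite_eq', Finset.mem_univ, if_true, Function.comp_apply]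
  have h : ∀ y : Fin k → α, ∏ a, (U : Matrix α α ℂ) (x.1 a) (y (p a))
      = ∏ a, (U : Matrix α α ℂ) (x.1 (p.symm a)) (y a) := fun y => by
    simpa using Equiv.prod_comp p fun a => (U : Matrix α α ℂ) (x.1 (p.symm a)) (y a)
  simp only [h, ← Finset.prod_mul_distrib]
  rw [← Fintype.prod_sum fun a c =>
    (U : Matrix α α ℂ) (x.1 (p.symm a)) c * star ((U : Matrix α α ℂ) (x.2 a) c)]
  simp only [hU]
  rw [Finset.prod_ite_zero]
  simp only [Finset.prod_const_one, Finset.mem_univ, true_imp_iff]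
  refine if_congr ?_ rfl rfl
  rw [funext_iff, ← p.forall_congr_right]
  simp

theorem fullMoment_mulVec_eq_self {w : Copies k α → ℂ}
    (hw : ∀ U : Matrix.unitaryGroup α ℂ, tensorKK k (U : Matrix α α ℂ) *ᵥ w = w) :
    fullMoment k α *ᵥ w = w := by
  ext x
  simp only [Matrix.mulVec, dotProduct, fullMoment, Matrix.of_apply, ← integral_mul_const]
  rw [← integral_finsetSum _ fun z _ => (integrable_tensorKK_apply x z).mul_const _]
  have h : ∀ U : Matrix.unitaryGroup α ℂ,
      ∑ z, tensorKK k (U : Matrix α α ℂ) x z * w z = w x := fun U => congrFun (hw U) x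
  simp [h]

theorem fullMoment_mulVec_pairVec (p : Equiv.Perm (Fin k)) :
    fullMoment k α *ᵥ pairVec p = pairVec p :=
  fullMoment_mulVec_eq_self fun U => tensorKK_mulVec_pairVec U p

/-- The moment operator is self-adjoint and fixes the real vector `pairVec p`. Testing against
pairings thus yields linear equations for the coefficients of a projected vector. -/
theorem pairVec_dotProduct_fullMoment_mulVec (p : Equiv.Perm (Fin k)) (w : Copies k α → ℂ) :
    pairVec p ⬝ᵥ (fullMoment k α *ᵥ w) = pairVec p ⬝ᵥ w := by
  have hs : star (pairVec p : Copies k α → ℂ) = pairVec p := by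
    ext x; simp [pairVec, apply_ite]
  have h := Matrix.star_mulVec (fullMoment k α) (pairVec p)
  rw [fullMoment_mulVec_pairVec, hs, isHermitian_fullMoment.eq] at h
  rw [Matrix.dotProduct_mulVec, ← h]

end Moment

/-! ### Classification of the invariants of two copies and two conjugate copies -/

theorem exists_perm_apply_eq {α : Type*} [DecidableEq α] {a b i j : α} (hab : a ≠ b) (hij : i ≠ j) :
    ∃ σ : Equiv.Perm α, σ a = i ∧ σ b = j := by
  have hb : i ≠ Equiv.swap a i b := fun h => hab <| by
    have := congrArg (Equiv.swap a i) h
    simpa using this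
  refine ⟨(Equiv.swap a i).trans (Equiv.swap (Equiv.swap a i b) j), ?_, ?_⟩
  · rw [Equiv.trans_apply, Equiv.swap_apply_left, Equiv.swap_apply_of_ne_of_ne hb hij]
  · rw [Equiv.trans_apply, Equiv.swap_apply_left]

/-- The nested form lets the four sums be evaluated one at a time when a row of `A` is sparse. -/
theorem tensorKK_two_mulVec {α : Type*} [Fintype α] (A : Matrix α α ℂ) (w : Copies 2 α → ℂ)
    (a b c d : α) :
    (tensorKK 2 A *ᵥ w) (![a, b], ![c, d]) = ∑ a', A a a' * ∑ b', A b b' *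
      ∑ c', star (A c c') * ∑ d', star (A d d') * w (![a', b'], ![c', d']) := by
  have h : ∀ f : (Fin 2 → α) → ℂ, ∑ x, f x = ∑ i, ∑ j, f ![i, j] := fun f => by
    rw [← (finTwoArrowEquiv α).symm.sum_comp, Fintype.sum_prod_type]
    rfl
  simp only [Matrix.mulVec, dotProduct, Fintype.sum_prod_type, h, tensorKK, Matrix.of_apply,
    Fin.prod_univ_two, Matrix.cons_val_zero, Matrix.cons_val_one, Finset.mul_sum]
  refine Finset.sum_congr rfl fun _ _ => Finset.sum_congr rfl fun _ _ =>
    Finset.sum_congr rfl fun _ _ => Finset.sum_congr rfl fun _ _ => ?_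
  ring

section Invariants

variable {α : Type*} [Fintype α] [DecidableEq α]

/-- The unitary matrix sending the basis vector `σ a` to `u a` times the basis vector `a`. -/
def monomialUnitary (u : α → ℂ) (hu : ∀ a, u a * star (u a) = 1) (σ : Equiv.Perm α) :
    Matrix.unitaryGroup α ℂ :=
  ⟨Matrix.of fun a b => if b = σ a then u a else 0, by
    rw [Matrix.mem_unitaryGroup_iff]
    ext a b
    simp only [Matrix.mul_apply, Matrix.star_apply, Matrix.of_apply, ite_mul, zero_mul,
      Finset.sum_ite_eq', Finset.mem_univ, if_true, Matrix.one_apply, σ.injective.eq_iff]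
    split_ifs with h
    · rw [h, hu]
    · simp⟩

/-- The reflection of `ℂ^α` along the vector `e_i + 2 e_j`. -/
noncomputable def reflectionUnitary (i j : α) (hij : i ≠ j) : Matrix.unitaryGroup α ℂ :=
  ⟨1 - (2 / 5 : ℂ) • Matrix.vecMulVec (Pi.single i 1 + Pi.single j 2)
      (Pi.single i 1 + Pi.single j 2), by
    set w : α → ℂ := Pi.single i 1 + Pi.single j 2 with hw
    have hs : star w = w := by
      ext a
      simp only [hw, Pi.star_apply, Pi.add_apply, Pi.single_apply]
      split_ifs <;> simp
    have hd : w ⬝ᵥ w = 5 := by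
      simp [hw, hij, hij.symm]
      norm_num
    rw [Matrix.mem_unitaryGroup_iff, Matrix.star_eq_conjTranspose, Matrix.conjTranspose_sub,
      Matrix.conjTranspose_smul, Matrix.conjTranspose_vecMulVec, hs, Matrix.conjTranspose_one,
      mul_sub, sub_mul, sub_mul, Matrix.smul_mul, Matrix.smul_mul, Matrix.mul_smul, Matrix.mul_smul,
      Matrix.vecMulVec_mul_vecMulVec, hd]
    have h5 : star (2 / 5 : ℂ) = 2 / 5 := by simp
    simp only [h5, one_mul, mul_one, Matrix.vecMulVec_smul]
    module⟩

theorem sum_reflectionUnitary_mul (i j : α) (hij : i ≠ j) (f : α → ℂ) :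
    ∑ a, (reflectionUnitary i j hij : Matrix α α ℂ) i a * f a = 3 / 5 * f i - 4 / 5 * f j := by
  have h : ∀ a, (reflectionUnitary i j hij : Matrix α α ℂ) i a * f a
      = (if a = i then 3 / 5 * f a else 0) - (if a = j then 4 / 5 * f a else 0) := fun a => by
    simp only [reflectionUnitary, Matrix.sub_apply, Matrix.one_apply, Matrix.smul_apply,
      Matrix.vecMulVec_apply, Pi.add_apply, Pi.single_apply, hij, smul_eq_mul]
    by_cases h1 : a = i
    · subst h1; norm_num [hij]
    · by_cases h2 : a = j
      · subst h2; norm_num [hij, h1]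
      · simp [h1, h2, Ne.symm h1]
  simp [h, Finset.sum_sub_distrib]

theorem sum_star_reflectionUnitary_mul (i j : α) (hij : i ≠ j) (f : α → ℂ) :
    ∑ a, star ((reflectionUnitary i j hij : Matrix α α ℂ) i a) * f a
      = 3 / 5 * f i - 4 / 5 * f j := by
  have h := congrArg star (sum_reflectionUnitary_mul i j hij (star f))
  simp only [star_sum, star_mul', star_sub, Pi.star_apply, star_star] at h
  simpa using h

/-- Three kinds of unitaries suffice. Diagonal phases kill all entries whose index pairs differ as
multisets, permutations reduce the rest to `F i j i j`, `F i j j i` and the diagonal, and one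
reflection makes the diagonal value the sum of the other two. -/
theorem exists_eq_of_tensorKK_two_mulVec_eq [Nontrivial α] {w : Copies 2 α → ℂ}
    (hw : ∀ U : Matrix.unitaryGroup α ℂ, tensorKK 2 (U : Matrix α α ℂ) *ᵥ w = w) :
    ∃ c d : ℂ, w = c • pairVec 1 + d • pairVec (Equiv.swap 0 1) := by
  obtain ⟨i, j, hij⟩ := exists_pair_ne α
  set F : α → α → α → α → ℂ := fun a b c d => w (![a, b], ![c, d]) with hF
  have hmon : ∀ (u : α → ℂ) (_ : ∀ a, u a * star (u a) = 1) (σ : Equiv.Perm α) a b c d,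
      F a b c d = u a * (u b * (star (u c) * (star (u d) * F (σ a) (σ b) (σ c) (σ d)))) := by
    intro u hu σ a b c d
    have h := congrFun (hw (monomialUnitary u hu σ)) (![a, b], ![c, d])
    rw [tensorKK_two_mulVec] at h
    rw [hF]
    simp only
    rw [← h]
    simp [monomialUnitary, apply_ite]
  have hperm : ∀ (σ : Equiv.Perm α) a b c d, F a b c d = F (σ a) (σ b) (σ c) (σ d) := by
    intro σ a b c d
    simpa using hmon (fun _ => 1) (by simp) σ a b c d
  have hphase : ∀ e a b c d : α, F a b c d = (if a = e then Complex.I else 1) *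
      ((if b = e then Complex.I else 1) * ((if c = e then -Complex.I else 1) *
        ((if d = e then -Complex.I else 1) * F a b c d))) := by
    intro e a b c d
    have h := hmon (fun x => if x = e then Complex.I else 1)
      (fun x => by split_ifs <;> simp) (Equiv.refl α) a b c d
    simpa only [Equiv.refl_apply, apply_ite star, star_one, Complex.star_def, Complex.conj_I]
      using h
  have hI : ∀ z : ℂ, z = Complex.I * z → z = 0 := fun z hz => by
    have h1 : (1 - Complex.I) * z = 0 := by linear_combination hz
    refine (mul_eq_zero.mp h1).resolve_left fun h0 => ?_
    have := congrArg Complex.re h0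
    simp at this
  have hzero : ∀ a b c d, F a b c d ≠ 0 → (a = c ∧ b = d) ∨ (a = d ∧ b = c) := by
    intro a b c d h
    by_contra hn
    apply h
    by_cases hac : a = c
    · subst hac
      have hbd : ¬ d = b := fun hbd => hn (Or.inl ⟨rfl, hbd.symm⟩)
      have h1 := hphase b a b a d
      simp only [if_true, hbd, if_false, one_mul] at h1
      refine hI _ ?_
      split_ifs at h1
      · linear_combination h1 - Complex.I * F a b a d * Complex.I_sq
      · linear_combination h1
    · by_cases had : a = d
      · subst had
        have hbc : ¬ c = b := fun hbc => hn (Or.inr ⟨rfl, hbc.symm⟩)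
        have h1 := hphase b a b c a
        simp only [if_true, hbc, if_false, one_mul] at h1
        refine hI _ ?_
        split_ifs at h1
        · linear_combination h1 - Complex.I * F a b c a * Complex.I_sq
        · linear_combination h1
      · have h1 := hphase a a b c d
        simp only [if_true, Ne.symm hac, Ne.symm had, if_false, one_mul] at h1
        split_ifs at h1
        · have h2 : F a b c d = - F a b c d := by
            linear_combination h1 + F a b c d * Complex.I_sq
          linear_combination h2 / 2
        · exact hI _ (by linear_combination h1)
  -- Row `i` of the reflection is (3/5, -4/5) on `i`, `j`. The invariance equation at `(i, i, i, i)`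
  -- reads F_iiii = (81 + 256)/625 F_iiii + 288/625 (F_ijij + F_ijji), and 1 - 337/625 = 288/625.
  have hdiag : ∀ a, F a a a a = F i j i j + F i j j i := by
    have hz : ∀ a b c d, ¬ ((a = c ∧ b = d) ∨ (a = d ∧ b = c)) → F a b c d = 0 :=
      fun a b c d h => by_contra fun h0 => h (hzero a b c d h0)
    have h := congrFun (hw (reflectionUnitary i j hij)) (![i, i], ![i, i])
    rw [tensorKK_two_mulVec] at h
    simp only [sum_reflectionUnitary_mul, sum_star_reflectionUnitary_mul] at h
    simp only [← show ∀ a b c d, F a b c d = w (![a, b], ![c, d]) from fun _ _ _ _ => rfl] at h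
    have hs := fun a b c d => hperm (Equiv.swap i j) a b c d
    have e1 := hs i i i i
    have e2 := hs i j i j
    have e3 := hs i j j i
    simp only [Equiv.swap_apply_left, Equiv.swap_apply_right] at e1 e2 e3
    rw [hz i i i j (by simp [hij]), hz i i j i (by simp [hij]), hz i j i i (by simp [hij.symm]),
      hz j i i i (by simp [hij.symm]), hz j j j i (by simp [hij.symm]),
      hz j j i j (by simp [hij.symm]), hz j i j j (by simp [hij]), hz i j j j (by simp [hij]),
      hz i i j j (by simp [hij]), hz j j i i (by simp [hij.symm]), ← e1, ← e2, ← e3] at h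
    intro a
    have ha := hperm (Equiv.swap a i) a a a a
    rw [Equiv.swap_apply_left] at ha
    rw [ha]
    linear_combination (-625 / 288 : ℂ) * h
  refine ⟨F i j i j, F i j j i, ?_⟩
  ext ⟨x, y⟩
  obtain ⟨a, b, rfl⟩ : ∃ a b, x = ![a, b] := ⟨x 0, x 1, by ext t; fin_cases t <;> rfl⟩
  obtain ⟨c, d, rfl⟩ : ∃ c d, y = ![c, d] := ⟨y 0, y 1, by ext t; fin_cases t <;> rfl⟩
  change F a b c d = _
  have h1 : pairVec (k := 2) 1 (![a, b], ![c, d]) = if a = c ∧ b = d then (1 : ℂ) else 0 := by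
    refine if_congr ?_ rfl rfl
    simp [funext_iff, Fin.forall_fin_two]
  have h2 : pairVec (k := 2) (Equiv.swap 0 1) (![a, b], ![c, d])
      = if a = d ∧ b = c then (1 : ℂ) else 0 := by
    refine if_congr ?_ rfl rfl
    simp [funext_iff, Fin.forall_fin_two]
  simp only [Pi.add_apply, Pi.smul_apply, h1, h2, smul_eq_mul, mul_ite, mul_one, mul_zero]
  by_cases hab : a = b
  · subst hab
    by_cases hcd : a = c ∧ a = d
    · obtain ⟨rfl, rfl⟩ := hcd
      simp [hdiag]
    · have : F a a c d = 0 := by_contra fun h0 => by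
        have := hzero _ _ _ _ h0
        tauto
      rw [this, if_neg hcd, if_neg (by tauto)]
      simp
  · obtain ⟨σ, rfl, rfl⟩ := exists_perm_apply_eq hab hij
    by_cases hcd : a = c ∧ b = d
    · obtain ⟨rfl, rfl⟩ := hcd
      rw [if_pos ⟨rfl, rfl⟩, if_neg (by tauto), ← hperm, add_zero]
    · by_cases hdc : a = d ∧ b = c
      · obtain ⟨rfl, rfl⟩ := hdc
        rw [if_neg hcd, if_pos ⟨rfl, rfl⟩, ← hperm σ a b b a, zero_add]
      · have : F a b c d = 0 := by_contra fun h0 => by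
          have := hzero _ _ _ _ h0
          tauto
        rw [this, if_neg hcd, if_neg hdc, add_zero]

theorem exists_fullMoment_two_mulVec_eq [Nontrivial α] (w : Copies 2 α → ℂ) :
    ∃ c d : ℂ, fullMoment 2 α *ᵥ w = c • pairVec 1 + d • pairVec (Equiv.swap 0 1) :=
  exists_eq_of_tensorKK_two_mulVec_eq fun U => by
    rw [Matrix.mulVec_mulVec, tensorKK_mul_fullMoment]

end Invariants

/-! ### Product vectors over the sites -/

section Sites

variable {W : Type*} {k : ℕ} {β : Type*}

/-- The part at the site `w` of a basis index of `2k` copies. -/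
def siteAt (w : W) (x : Copies k (W → β)) : Copies k β := (fun a => x.1 a w, fun a => x.2 a w)

/-- Basis indices of `2k` copies of a system of sites, listed site by site. -/
def copiesPiEquiv (k : ℕ) (W β : Type*) : Copies k (W → β) ≃ (W → Copies k β) where
  toFun x w := siteAt w x
  invFun y := (fun a w => (y w).1 a, fun a w => (y w).2 a)
  left_inv _ := rfl
  right_inv _ := rfl

variable [Fintype W]

/-- The product vector `⨂_w f_w`. -/
def siteProd (f : W → Copies k β → ℂ) (x : Copies k (W → β)) : ℂ := ∏ w, f w (siteAt w x)

theorem siteProd_pairVec [DecidableEq β] (p : Equiv.Perm (Fin k)) :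
    siteProd (fun _ : W => pairVec (β := β) p) = pairVec p := by
  ext x
  simp only [siteProd, pairVec, Finset.prod_ite_zero, Finset.prod_const_one, Finset.mem_univ,
    true_imp_iff]
  refine if_congr ?_ rfl rfl
  simp only [funext_iff, siteAt, Function.comp_apply]
  exact forall_comm

theorem siteProd_dotProduct_siteProd [DecidableEq W] [Fintype β] (f g : W → Copies k β → ℂ) :
    siteProd f ⬝ᵥ siteProd g = ∏ w, f w ⬝ᵥ g w := by
  simp only [dotProduct, siteProd, ← Finset.prod_mul_distrib]
  rw [Fintype.prod_sum, ← (copiesPiEquiv k W β).sum_comp]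
  rfl

/-- Computational basis vectors are product vectors, so linear statements need only be checked on
products. -/
theorem span_range_siteProd [DecidableEq W] [Fintype β] [DecidableEq β] :
    Submodule.span ℂ (Set.range (siteProd : (W → Copies k β → ℂ) → _)) = ⊤ := by
  rw [eq_top_iff, ← (Pi.basisFun ℂ (Copies k (W → β))).span_eq, Submodule.span_le]
  rintro _ ⟨x, rfl⟩
  refine Submodule.subset_span ⟨fun w => Pi.single (siteAt w x) 1, ?_⟩
  ext y
  simp only [siteProd, Pi.basisFun_apply, Pi.single_apply, Finset.prod_ite_zero,
    Finset.prod_const_one, Finset.mem_univ, true_imp_iff]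
  refine if_congr ?_ rfl rfl
  rw [← (copiesPiEquiv k W β).injective.eq_iff, funext_iff]
  rfl

end Sites

theorem pairVec_dotProduct_self {β : Type*} [Fintype β] [DecidableEq β] {k : ℕ}
    (p : Equiv.Perm (Fin k)) :
    (pairVec p : Copies k β → ℂ) ⬝ᵥ pairVec p = (Fintype.card β : ℂ) ^ k := by
  simp only [dotProduct, pairVec, Fintype.sum_prod_type]
  rw [Finset.sum_comm]
  simp

theorem pairVec_one_dotProduct_swap {β : Type*} [Fintype β] [DecidableEq β] :
    (pairVec (k := 2) 1 : Copies 2 β → ℂ) ⬝ᵥ pairVec (Equiv.swap 0 1) = Fintype.card β := by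
  simp only [dotProduct, Fintype.sum_prod_type]
  rw [Finset.sum_comm]
  have hy : ∀ y : Fin 2 → β, ∑ x, pairVec 1 (x, y) * pairVec (Equiv.swap 0 1) (x, y)
      = if y = y ∘ (Equiv.swap 0 1 : Equiv.Perm (Fin 2)) then (1 : ℂ) else 0 := fun y => by
    -- The identity pairing forces `x = y`; the swap then leaves only the constant tuples to count.
    rw [Finset.sum_eq_single y (fun x _ hx => by simp [pairVec, hx]) (by simp)]
    simp [pairVec]
  simp only [hy]
  rw [← (finTwoArrowEquiv β).symm.sum_comp, Fintype.sum_prod_type]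
  have h : ∀ a b : β, ((finTwoArrowEquiv β).symm (a, b)
      = (finTwoArrowEquiv β).symm (a, b) ∘ (Equiv.swap 0 1 : Equiv.Perm (Fin 2))) ↔ a = b := by
    intro a b
    simp [funext_iff, Fin.forall_fin_two, eq_comm]
  simp only [h]
  simp

/-! ### Moment operators of subsets of sites, acting on product vectors -/

section Restriction

variable {V : Type*} [Fintype V] [DecidableEq V] {q k : ℕ}

/-- The part on the sites in `S` of a basis index of `2k` copies. -/
def restrict (S : Finset V) (x : Copies k (V → Fin q)) : Copies k (SiteConfig q S) :=
  (fun a v => x.1 a v, fun a v => x.2 a v)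

/-- The basis index which is `z` on the sites in `S` and `x` on the others. -/
def glue (S : Finset V) (x : Copies k (V → Fin q)) (z : Copies k (SiteConfig q S)) :
    Copies k (V → Fin q) :=
  (fun a v => if h : v ∈ S then z.1 a ⟨v, h⟩ else x.1 a v,
    fun a v => if h : v ∈ S then z.2 a ⟨v, h⟩ else x.2 a v)

theorem haarMoment_apply (S : Finset V) (x y : Copies k (V → Fin q)) :
    haarMoment q k S x y = if ∀ v, v ∉ S → siteAt v x = siteAt v y then
      fullMoment k (SiteConfig q S) (restrict S x) (restrict S y) else 0 := by
  have h : ∀ U : Matrix (SiteConfig q S) (SiteConfig q S) ℂ, tensorKK k (extendOp S U) x y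
      = if ∀ v, v ∉ S → siteAt v x = siteAt v y then
        tensorKK k U (restrict S x) (restrict S y) else 0 := fun U => by
    simp only [tensorKK, extendOp, Matrix.of_apply, apply_ite star, star_zero,
      Finset.prod_ite_zero, Finset.mem_univ, true_imp_iff, ite_zero_mul_ite_zero]
    refine if_congr ?_ rfl rfl
    simp only [siteAt, Prod.mk.injEq, funext_iff]
    exact ⟨fun h v hv => ⟨fun a => h.1 a v hv, fun a => h.2 a v hv⟩,
      fun h => ⟨fun a v hv => (h v hv).1 a, fun a v hv => (h v hv).2 a⟩⟩
  simp only [haarMoment, fullMoment, Matrix.of_apply, h]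
  split_ifs <;> simp

theorem isHermitian_haarMoment (S : Finset V) : (haarMoment q k S).IsHermitian := by
  ext x y
  rw [Matrix.conjTranspose_apply, haarMoment_apply, haarMoment_apply, apply_ite star, star_zero]
  exact if_congr (by simp only [eq_comm]) (isHermitian_fullMoment.apply _ _) rfl

theorem haarMoment_mulVec_apply (S : Finset V) (f : Copies k (V → Fin q) → ℂ)
    (x : Copies k (V → Fin q)) :
    (haarMoment q k S *ᵥ f) x
      = ∑ z, fullMoment k (SiteConfig q S) (restrict S x) z * f (glue S x z) := by
  simp only [Matrix.mulVec, dotProduct, haarMoment_apply, ite_mul, zero_mul]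
  rw [← Finset.sum_filter]
  have hr : ∀ z, restrict S (glue S x z) = z := fun z => by
    ext <;> simp [restrict, glue]
  refine Finset.sum_nbij' (restrict S) (glue S x) (by simp) ?_ ?_ (fun z _ => hr z) ?_
  · intro z _
    rw [Finset.mem_filter]
    refine ⟨Finset.mem_univ _, fun v hv => ?_⟩
    simp [siteAt, glue, hv]
  · intro y hy
    rw [Finset.mem_filter] at hy
    have hy' := fun v hv => Prod.ext_iff.mp (hy.2 v hv)
    simp only [siteAt, funext_iff] at hy'
    ext a v
    · by_cases hv : v ∈ S <;> simp [glue, restrict, hv, hy' v]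
    · by_cases hv : v ∈ S <;> simp [glue, restrict, hv, hy' v]
  · intro y hy
    rw [Finset.mem_filter] at hy
    have hy' := fun v hv => Prod.ext_iff.mp (hy.2 v hv)
    simp only [siteAt, funext_iff] at hy'
    have : glue S x (restrict S y) = y := by
      ext a v
      · by_cases hv : v ∈ S <;> simp [glue, restrict, hv, hy' v]
      · by_cases hv : v ∈ S <;> simp [glue, restrict, hv, hy' v]
    rw [this]

theorem siteProd_eq_mul (S : Finset V) (f : V → Copies k (Fin q) → ℂ)
    (x : Copies k (V → Fin q)) :
    siteProd f x = (∏ v ∈ Sᶜ, f v (siteAt v x)) *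
      siteProd (fun v : {v // v ∈ S} => f v) (restrict S x) := by
  rw [siteProd, ← Finset.prod_mul_prod_compl S, mul_comm, ← Finset.prod_coe_sort S]
  rfl

theorem haarMoment_mulVec_siteProd_apply (S : Finset V) (f : V → Copies k (Fin q) → ℂ)
    (x : Copies k (V → Fin q)) :
    (haarMoment q k S *ᵥ siteProd f) x = (∏ v ∈ Sᶜ, f v (siteAt v x)) *
      (fullMoment k (SiteConfig q S) *ᵥ siteProd fun v : {v // v ∈ S} => f v) (restrict S x) := by
  have hr : ∀ z, restrict S (glue S x z) = z := fun z => by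
    ext <;> simp [restrict, glue]
  have hs : ∀ z, ∏ v ∈ Sᶜ, f v (siteAt v (glue S x z)) = ∏ v ∈ Sᶜ, f v (siteAt v x) := fun z =>
    Finset.prod_congr rfl fun v hv => by
      rw [Finset.mem_compl] at hv
      simp [siteAt, glue, hv]
  rw [haarMoment_mulVec_apply]
  simp only [Matrix.mulVec, dotProduct, Finset.mul_sum, siteProd_eq_mul S f, hr, hs]
  exact Finset.sum_congr rfl fun z _ => by ring

/-- The family of site vectors `f`, replaced by `pairVec p` on the sites in `S`. -/
def pairOn (S : Finset V) (f : V → Copies k (Fin q) → ℂ) (p : Equiv.Perm (Fin k)) :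
    V → Copies k (Fin q) → ℂ :=
  fun v => if v ∈ S then pairVec p else f v

theorem siteProd_pairOn (S : Finset V) (f : V → Copies k (Fin q) → ℂ) (p : Equiv.Perm (Fin k))
    (x : Copies k (V → Fin q)) :
    siteProd (pairOn S f p) x = (∏ v ∈ Sᶜ, f v (siteAt v x)) * pairVec p (restrict S x) := by
  rw [siteProd_eq_mul S, ← siteProd_pairVec]
  congr 1
  · exact Finset.prod_congr rfl fun v hv => by rw [pairOn, if_neg (Finset.mem_compl.mp hv)]
  · congr 1
    ext v : 1
    simp [pairOn]

theorem haarMoment_mulVec_siteProd_pairOn (S : Finset V) (f : V → Copies k (Fin q) → ℂ)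
    (p : Equiv.Perm (Fin k)) :
    haarMoment q k S *ᵥ siteProd (pairOn S f p) = siteProd (pairOn S f p) := by
  ext x
  have h : (fun v : {v // v ∈ S} => pairOn S f p v) = fun _ => pairVec p := by
    ext v : 1
    simp [pairOn]
  rw [haarMoment_mulVec_siteProd_apply, h, siteProd_pairVec, fullMoment_mulVec_pairVec,
    siteProd_pairOn]
  congr 1
  exact Finset.prod_congr rfl fun v hv => by rw [pairOn, if_neg (Finset.mem_compl.mp hv)]

theorem haarMoment_mulVec_siteProd_of_fullMoment {S : Finset V} {f : V → Copies 2 (Fin q) → ℂ}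
    {c d : ℂ} (h : (fullMoment 2 (SiteConfig q S) *ᵥ siteProd fun v : {v // v ∈ S} => f v)
      = c • pairVec 1 + d • pairVec (Equiv.swap 0 1)) :
    haarMoment q 2 S *ᵥ siteProd f
      = c • siteProd (pairOn S f 1) + d • siteProd (pairOn S f (Equiv.swap 0 1)) := by
  ext x
  rw [haarMoment_mulVec_siteProd_apply, h]
  simp only [Pi.add_apply, Pi.smul_apply, siteProd_pairOn, smul_eq_mul]
  ring

theorem exists_haarMoment_two_mulVec_siteProd (hq : 2 ≤ q) {S : Finset V} (hS : S.Nonempty)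
    (f : V → Copies 2 (Fin q) → ℂ) :
    ∃ c d : ℂ, haarMoment q 2 S *ᵥ siteProd f
      = c • siteProd (pairOn S f 1) + d • siteProd (pairOn S f (Equiv.swap 0 1)) := by
  have : Nontrivial (Fin q) := Fin.nontrivial_iff_two_le.mpr hq
  have : Nonempty {v // v ∈ S} := hS.to_subtype
  obtain ⟨c, d, h⟩ := exists_fullMoment_two_mulVec_eq
    (siteProd fun v : {v // v ∈ S} => f v)
  exact ⟨c, d, haarMoment_mulVec_siteProd_of_fullMoment h⟩

/-- Testing against the two pairings on `{i, j}` gives q³ = c q⁴ + d q² and q³ = c q² + d q⁴. Since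
q² ≠ 1, these force c = d = q/(q²+1). -/
theorem haarMoment_two_mulVec_siteProd_of_ne (hq : 2 ≤ q) {i j : V} (hij : i ≠ j)
    {f : V → Copies 2 (Fin q) → ℂ} (hi : f i = pairVec 1) (hj : f j = pairVec (Equiv.swap 0 1)) :
    haarMoment q 2 {i, j} *ᵥ siteProd f = ((q : ℂ) / (q ^ 2 + 1)) •
      (siteProd (pairOn {i, j} f 1) + siteProd (pairOn {i, j} f (Equiv.swap 0 1))) := by
  have : Nontrivial (Fin q) := Fin.nontrivial_iff_two_le.mpr hq
  have : Nonempty {v // v ∈ ({i, j} : Finset V)} := ⟨⟨i, by simp⟩⟩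
  obtain ⟨c, d, h⟩ := exists_fullMoment_two_mulVec_eq
    (siteProd fun v : {v // v ∈ ({i, j} : Finset V)} => f v)
  have hdot : ∀ p : Equiv.Perm (Fin 2), ∀ g : V → Copies 2 (Fin q) → ℂ,
      pairVec p ⬝ᵥ (siteProd fun v : {v // v ∈ ({i, j} : Finset V)} => g v)
        = (pairVec p ⬝ᵥ g i) * (pairVec p ⬝ᵥ g j) := fun p g => by
    rw [← siteProd_pairVec, siteProd_dotProduct_siteProd,
      Finset.prod_coe_sort {i, j} fun v => pairVec p ⬝ᵥ g v, Finset.prod_pair hij]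
  have hdotp : ∀ p r : Equiv.Perm (Fin 2),
      (pairVec p : Copies 2 (SiteConfig q ({i, j} : Finset V)) → ℂ) ⬝ᵥ pairVec r
        = ((pairVec p : Copies 2 (Fin q) → ℂ) ⬝ᵥ pairVec r) ^ 2 := fun p r => by
    rw [← siteProd_pairVec r, sq]
    exact hdot p fun _ => pairVec r
  have h1 := congrArg (pairVec 1 ⬝ᵥ ·) h
  have h2 := congrArg (pairVec (Equiv.swap 0 1) ⬝ᵥ ·) h
  have hc : (pairVec (Equiv.swap 0 1) : Copies 2 (Fin q) → ℂ) ⬝ᵥ pairVec 1 = q := by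
    rw [dotProduct_comm, pairVec_one_dotProduct_swap, Fintype.card_fin]
  simp only [pairVec_dotProduct_fullMoment_mulVec, hdot, hi, hj, dotProduct_add,
    dotProduct_smul, hdotp, pairVec_dotProduct_self, pairVec_one_dotProduct_swap, hc,
    Fintype.card_fin, smul_eq_mul] at h1 h2
  have hq0 : (q : ℂ) ≠ 0 := by exact_mod_cast (by omega : q ≠ 0)
  have hq1 : (q : ℂ) ^ 2 + 1 ≠ 0 := by exact_mod_cast (by positivity : q ^ 2 + 1 ≠ 0)
  have hq2 : (q : ℂ) ^ 2 - 1 ≠ 0 := fun h0 => by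
    have h3 : ((q ^ 2 : ℕ) : ℂ) = (1 : ℕ) := by push_cast; linear_combination h0
    have h4 : q ^ 2 = 1 := by exact_mod_cast h3
    nlinarith
  have hcd : c = d := by
    have h3 : (c - d) * ((q : ℂ) ^ 2 * (q ^ 2 - 1)) = 0 := by linear_combination h2 - h1
    exact sub_eq_zero.mp ((mul_eq_zero.mp h3).resolve_right (by positivity))
  subst hcd
  have hcq : c = (q : ℂ) / (q ^ 2 + 1) := by
    rw [eq_div_iff hq1]
    refine mul_left_cancel₀ (pow_ne_zero 2 hq0) ?_
    linear_combination -h1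
  rw [haarMoment_mulVec_siteProd_of_fullMoment h, hcq, smul_add]

end Restriction

theorem mem_spectrum_real_iff {α : Type*} [Fintype α] [DecidableEq α] (H : Matrix α α ℂ) (r : ℝ) :
    r ∈ spectrum ℝ H ↔ ∃ v ≠ 0, H *ᵥ v = (r : ℂ) • v := by
  rw [spectrum.mem_iff, Matrix.isUnit_iff_isUnit_det, isUnit_iff_ne_zero, not_not,
    ← Matrix.exists_mulVec_eq_zero_iff]
  refine exists_congr fun v => and_congr_right fun _ => ?_
  have h : (algebraMap ℝ (Matrix α α ℂ) r) *ᵥ v = (r : ℂ) • v := by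
    rw [Algebra.algebraMap_eq_smul_one, Matrix.smul_mulVec, Matrix.one_mulVec]
    rfl
  rw [Matrix.sub_mulVec, h, sub_eq_zero, eq_comm]

/-! ### Moment operators on products of pairings -/

section PermVec

variable {V : Type*} [Fintype V] [DecidableEq V] {q : ℕ}

/-- The product of the pairing vectors of the permutations `σ v`. -/
def permVec (q : ℕ) {k : ℕ} (σ : V → Equiv.Perm (Fin k)) : Copies k (V → Fin q) → ℂ :=
  siteProd fun v => pairVec (σ v)

/-- The image of a product vector is a combination of products carrying a single pairing on `S`, and
these are fixed. -/
theorem haarMoment_two_mul_self (hq : 2 ≤ q) {S : Finset V} (hS : S.Nonempty)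
    (v : Copies 2 (V → Fin q) → ℂ) :
    haarMoment q 2 S *ᵥ (haarMoment q 2 S *ᵥ v) = haarMoment q 2 S *ᵥ v := by
  have hv : v ∈ Submodule.span ℂ (Set.range siteProd) := by
    rw [span_range_siteProd]; trivial
  induction hv using Submodule.span_induction with
  | mem _ h =>
    obtain ⟨f, rfl⟩ := h
    obtain ⟨c, d, h⟩ := exists_haarMoment_two_mulVec_siteProd hq hS f
    simp only [h, Matrix.mulVec_add, Matrix.mulVec_smul, haarMoment_mulVec_siteProd_pairOn]
  | zero => simp
  | add _ _ _ _ h1 h2 => simp only [Matrix.mulVec_add, h1, h2]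
  | smul _ _ _ h => simp only [Matrix.mulVec_smul, h]

/-- The inner operator puts pairings on `T` and the outer one on `S`, so no site keeps its original
factor. -/
theorem haarMoment_two_mulVec_mulVec_mem_span (hq : 2 ≤ q) {S T : Finset V} (hS : S.Nonempty)
    (hT : T.Nonempty) (hST : ∀ v, v ∈ S ∨ v ∈ T) (v : Copies 2 (V → Fin q) → ℂ) :
    haarMoment q 2 S *ᵥ (haarMoment q 2 T *ᵥ v) ∈
      Submodule.span ℂ (Set.range (permVec q : (V → Equiv.Perm (Fin 2)) → _)) := by
  have hv : v ∈ Submodule.span ℂ (Set.range siteProd) := by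
    rw [span_range_siteProd]; trivial
  induction hv using Submodule.span_induction with
  | mem _ h =>
    obtain ⟨f, rfl⟩ := h
    have key : ∀ p r, siteProd (pairOn S (pairOn T f p) r) ∈
        Submodule.span ℂ (Set.range (permVec q : (V → Equiv.Perm (Fin 2)) → _)) := fun p r => by
      refine Submodule.subset_span ⟨fun v => if v ∈ S then r else p, ?_⟩
      refine congrArg siteProd (funext fun v => ?_)
      by_cases hv : v ∈ S
      · simp [pairOn, hv]
      · simp [pairOn, hv, (hST v).resolve_left hv]
    have key' : ∀ p, haarMoment q 2 S *ᵥ siteProd (pairOn T f p) ∈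
        Submodule.span ℂ (Set.range (permVec q : (V → Equiv.Perm (Fin 2)) → _)) := fun p => by
      obtain ⟨c, d, h⟩ := exists_haarMoment_two_mulVec_siteProd hq hS (pairOn T f p)
      rw [h]
      exact add_mem (Submodule.smul_mem _ _ (key _ _)) (Submodule.smul_mem _ _ (key _ _))
    obtain ⟨c, d, h⟩ := exists_haarMoment_two_mulVec_siteProd hq hT f
    rw [h, Matrix.mulVec_add, Matrix.mulVec_smul, Matrix.mulVec_smul]
    exact add_mem (Submodule.smul_mem _ _ (key' _)) (Submodule.smul_mem _ _ (key' _))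
  | zero => simp
  | add _ _ _ _ h1 h2 => simpa only [Matrix.mulVec_add] using add_mem h1 h2
  | smul _ _ _ h => simpa only [Matrix.mulVec_smul] using Submodule.smul_mem _ _ h

theorem haarMoment_mulVec_permVec_of_eq {k : ℕ} {i j : V} {σ : V → Equiv.Perm (Fin k)}
    (h : σ i = σ j) : haarMoment q k {i, j} *ᵥ permVec q σ = permVec q σ := by
  have : permVec q σ = siteProd (pairOn {i, j} (fun v => pairVec (σ v)) (σ i)) := by
    refine congrArg siteProd (funext fun v => ?_)
    by_cases hi : v = i
    · simp [pairOn, hi]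
    · by_cases hj : v = j
      · simp [pairOn, hj, h]
      · simp [pairOn, hi, hj]
  rw [this, haarMoment_mulVec_siteProd_pairOn]

theorem haarMoment_two_mulVec_permVec_of_ne (hq : 2 ≤ q) {i j : V} (hij : i ≠ j)
    {σ : V → Equiv.Perm (Fin 2)} (h : σ i ≠ σ j) :
    haarMoment q 2 {i, j} *ᵥ permVec q σ = ((q : ℂ) / (q ^ 2 + 1)) •
      (permVec q (fun v => if v = i ∨ v = j then 1 else σ v) +
        permVec q (fun v => if v = i ∨ v = j then Equiv.swap 0 1 else σ v)) := by
  have hp : ∀ p, permVec q (fun v => if v = i ∨ v = j then p else σ v)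
      = siteProd (pairOn {i, j} (fun v => pairVec (σ v)) p) := fun p => by
    refine congrArg siteProd (funext fun v => ?_)
    by_cases hi : v = i ∨ v = j <;> simp [pairOn, hi]
  have hperm : ∀ p r : Equiv.Perm (Fin 2), p ≠ r →
      (p = 1 ∧ r = Equiv.swap 0 1) ∨ (r = 1 ∧ p = Equiv.swap 0 1) := by decide
  rw [hp, hp]
  rcases hperm _ _ h with ⟨h1, h2⟩ | ⟨h1, h2⟩
  · exact haarMoment_two_mulVec_siteProd_of_ne hq hij (congrArg pairVec h1) (congrArg pairVec h2)
  · rw [Finset.pair_comm i j]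
    exact haarMoment_two_mulVec_siteProd_of_ne hq hij.symm (congrArg pairVec h1)
      (congrArg pairVec h2)

end PermVec

/-! ### The spectrum on three sites -/

section ThreeSites

variable {q : ℕ}

/-- The sum of the Haar moment operators of the three pairs of sites. -/
noncomputable def pairMomentSum (q : ℕ) :
    Matrix (Copies 2 (Fin 3 → Fin q)) (Copies 2 (Fin 3 → Fin q)) ℂ :=
  haarMoment q 2 {0, 1} + haarMoment q 2 {1, 2} + haarMoment q 2 {2, 0}

theorem mem_span_permVec_of_pairMomentSum_mulVec (hq : 2 ≤ q) {μ : ℂ} (h0 : μ ≠ 0) (h1 : μ ≠ 1)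
    {v : Copies 2 (Fin 3 → Fin q) → ℂ} (hv : pairMomentSum q *ᵥ v = μ • v) :
    v ∈ Submodule.span ℂ (Set.range (permVec q : (Fin 3 → Equiv.Perm (Fin 2)) → _)) := by
  set L := Submodule.span ℂ (Set.range (permVec q : (Fin 3 → Equiv.Perm (Fin 2)) → _)) with hL
  have hadd := hv
  rw [pairMomentSum, Matrix.add_mulVec, Matrix.add_mulVec] at hadd
  have hS : ∀ i j : Fin 3, ({i, j} : Finset (Fin 3)).Nonempty := fun i j => ⟨i, by simp⟩
  have hmem : ∀ {x : Copies 2 (Fin 3 → Fin q) → ℂ}, (μ - 1) • x ∈ L → x ∈ L := fun h =>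
    (Submodule.smul_mem_iff _ (sub_ne_zero.mpr h1)).mp h
  have hproj := fun i j => haarMoment_two_mul_self hq (hS i j) v
  have hmix := fun i j i' j' h => haarMoment_two_mulVec_mulVec_mem_span (q := q) hq
    (hS i j) (hS i' j') h v
  have ha : haarMoment q 2 {0, 1} *ᵥ v ∈ L := hmem <| by
    -- By idempotence the `{0, 1}` term reproduces itself; moved to the other side it gives the
    -- factor `μ - 1`, and only mixed products remain.
    have h := congrArg (haarMoment q 2 {0, 1} *ᵥ ·) hadd
    simp only [Matrix.mulVec_add, Matrix.mulVec_smul, hproj 0 1] at h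
    rw [sub_smul, one_smul, ← h, add_assoc, add_sub_cancel_left]
    exact add_mem (hmix _ _ _ _ (by decide)) (hmix _ _ _ _ (by decide))
  have hb : haarMoment q 2 {1, 2} *ᵥ v ∈ L := hmem <| by
    have h := congrArg (haarMoment q 2 {1, 2} *ᵥ ·) hadd
    simp only [Matrix.mulVec_add, Matrix.mulVec_smul, hproj 1 2] at h
    rw [sub_smul, one_smul, ← h, add_right_comm, add_sub_cancel_right]
    exact add_mem (hmix _ _ _ _ (by decide)) (hmix _ _ _ _ (by decide))
  have hc : haarMoment q 2 {2, 0} *ᵥ v ∈ L := hmem <| by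
    have h := congrArg (haarMoment q 2 {2, 0} *ᵥ ·) hadd
    simp only [Matrix.mulVec_add, Matrix.mulVec_smul, hproj 2 0] at h
    rw [sub_smul, one_smul, ← h, add_sub_cancel_right]
    exact add_mem (hmix _ _ _ _ (by decide)) (hmix _ _ _ _ (by decide))
  rw [← Submodule.smul_mem_iff L h0, ← hadd]
  exact add_mem (add_mem ha hb) hc

theorem pairMomentSum_mulVec_permVec_of_const (p : Equiv.Perm (Fin 2)) :
    pairMomentSum q *ᵥ permVec q ![p, p, p] = (3 : ℂ) • permVec q ![p, p, p] := by
  rw [pairMomentSum, Matrix.add_mulVec, Matrix.add_mulVec, 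
    haarMoment_mulVec_permVec_of_eq (i := 0) (j := 1) rfl,
    haarMoment_mulVec_permVec_of_eq (i := 1) (j := 2) rfl,
    haarMoment_mulVec_permVec_of_eq (i := 2) (j := 0) rfl]
  module

theorem update_pair_zero_one {γ : Type*} (a b c p : γ) :
    (fun v : Fin 3 => if v = 0 ∨ v = 1 then p else ![a, b, c] v) = ![p, p, c] := by
  ext v; fin_cases v <;> simp

theorem update_pair_one_two {γ : Type*} (a b c p : γ) :
    (fun v : Fin 3 => if v = 1 ∨ v = 2 then p else ![a, b, c] v) = ![a, p, p] := by
  ext v; fin_cases v <;> simp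

theorem update_pair_two_zero {γ : Type*} (a b c p : γ) :
    (fun v : Fin 3 => if v = 2 ∨ v = 0 then p else ![a, b, c] v) = ![p, b, p] := by
  ext v; fin_cases v <;> simp

theorem add_eq_add_of_perm_ne {γ : Type*} [AddCommMonoid γ] (g : Equiv.Perm (Fin 2) → γ)
    {p r : Equiv.Perm (Fin 2)} (h : p ≠ r) : g 1 + g (Equiv.swap 0 1) = g p + g r := by
  have hperm : ∀ p r : Equiv.Perm (Fin 2), p ≠ r →
      (p = 1 ∧ r = Equiv.swap 0 1) ∨ (r = 1 ∧ p = Equiv.swap 0 1) := by decide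
  rcases hperm p r h with ⟨rfl, rfl⟩ | ⟨rfl, rfl⟩
  · rfl
  · exact add_comm _ _

theorem haarMoment_zero_one_mulVec_permVec (hq : 2 ≤ q) {a b : Equiv.Perm (Fin 2)} (h : a ≠ b)
    (c : Equiv.Perm (Fin 2)) :
    haarMoment q 2 {0, 1} *ᵥ permVec q ![a, b, c] = ((q : ℂ) / (q ^ 2 + 1)) •
      (permVec q ![a, a, c] + permVec q ![b, b, c]) := by
  rw [haarMoment_two_mulVec_permVec_of_ne hq (by decide) h, update_pair_zero_one,
    update_pair_zero_one, add_eq_add_of_perm_ne (fun s => permVec q ![s, s, c]) h]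

theorem haarMoment_one_two_mulVec_permVec (hq : 2 ≤ q) {b c : Equiv.Perm (Fin 2)} (h : b ≠ c)
    (a : Equiv.Perm (Fin 2)) :
    haarMoment q 2 {1, 2} *ᵥ permVec q ![a, b, c] = ((q : ℂ) / (q ^ 2 + 1)) •
      (permVec q ![a, b, b] + permVec q ![a, c, c]) := by
  rw [haarMoment_two_mulVec_permVec_of_ne hq (by decide) h, update_pair_one_two,
    update_pair_one_two, add_eq_add_of_perm_ne (fun s => permVec q ![a, s, s]) h]

theorem haarMoment_two_zero_mulVec_permVec (hq : 2 ≤ q) {a c : Equiv.Perm (Fin 2)} (h : c ≠ a)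
    (b : Equiv.Perm (Fin 2)) :
    haarMoment q 2 {2, 0} *ᵥ permVec q ![a, b, c] = ((q : ℂ) / (q ^ 2 + 1)) •
      (permVec q ![c, b, c] + permVec q ![a, b, a]) := by
  rw [haarMoment_two_mulVec_permVec_of_ne hq (by decide) h, update_pair_two_zero,
    update_pair_two_zero, add_eq_add_of_perm_ne (fun s => permVec q ![s, b, s]) h]

theorem pairMomentSum_mulVec_permVec_zero (hq : 2 ≤ q) {p r : Equiv.Perm (Fin 2)} (h : p ≠ r) :
    pairMomentSum q *ᵥ permVec q ![r, p, p] = permVec q ![r, p, p] + ((q : ℂ) / (q ^ 2 + 1)) •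
      ((2 : ℂ) • permVec q ![p, p, p] + permVec q ![r, p, r] + permVec q ![r, r, p]) := by
  rw [pairMomentSum, Matrix.add_mulVec, Matrix.add_mulVec,
    haarMoment_zero_one_mulVec_permVec hq h.symm,
    haarMoment_mulVec_permVec_of_eq (i := 1) (j := 2) rfl,
    haarMoment_two_zero_mulVec_permVec hq h]
  module

theorem pairMomentSum_mulVec_permVec_one (hq : 2 ≤ q) {p r : Equiv.Perm (Fin 2)} (h : p ≠ r) :
    pairMomentSum q *ᵥ permVec q ![p, r, p] = permVec q ![p, r, p] + ((q : ℂ) / (q ^ 2 + 1)) •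
      ((2 : ℂ) • permVec q ![p, p, p] + permVec q ![p, r, r] + permVec q ![r, r, p]) := by
  rw [pairMomentSum, Matrix.add_mulVec, Matrix.add_mulVec,
    haarMoment_zero_one_mulVec_permVec hq h, haarMoment_one_two_mulVec_permVec hq h.symm,
    haarMoment_mulVec_permVec_of_eq (i := 2) (j := 0) rfl]
  module

theorem pairMomentSum_mulVec_permVec_two (hq : 2 ≤ q) {p r : Equiv.Perm (Fin 2)} (h : p ≠ r) :
    pairMomentSum q *ᵥ permVec q ![p, p, r] = permVec q ![p, p, r] + ((q : ℂ) / (q ^ 2 + 1)) •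
      ((2 : ℂ) • permVec q ![p, p, p] + permVec q ![p, r, r] + permVec q ![r, p, r]) := by
  rw [pairMomentSum, Matrix.add_mulVec, Matrix.add_mulVec,
    haarMoment_mulVec_permVec_of_eq (i := 0) (j := 1) rfl,
    haarMoment_one_two_mulVec_permVec hq h, haarMoment_two_zero_mulVec_permVec hq h.symm]
  module

/-- The polynomial in `Q` which annihilates the span of the vectors `permVec q σ`. -/
def annihilator {M : Type*} [AddCommGroup M] [Module ℂ M] (Q : Module.End ℂ M) (t : ℂ) :
    Module.End ℂ M :=
  (Q - (3 : ℂ) • 1) * ((Q - 1) * (Q - 1) - (4 * t ^ 2) • 1) * ((Q - 1) * (Q - 1) - t ^ 2 • 1)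

/-- Modulo `E` and `S`, (Q - 1)² acts on the triple `x` as t²(J - I)² = t²(J + I). Its t²-factor
leaves only the multiple t² of the sum of the `x`, the 4t²-factor kills that sum, and Q - 3 removes
what is left in `E` and `S`. -/
theorem annihilator_apply_eq_zero {M : Type*} [AddCommGroup M] [Module ℂ M]
    {Q : Module.End ℂ M} {t : ℂ} {E S x₀ x₁ x₂ y₀ y₁ y₂ : M}
    (hE : Q E = (3 : ℂ) • E) (hS : Q S = (3 : ℂ) • S)
    (hx₀ : Q x₀ = x₀ + t • ((2 : ℂ) • E + y₁ + y₂)) (hx₁ : Q x₁ = x₁ + t • ((2 : ℂ) • E + y₀ + y₂))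
    (hx₂ : Q x₂ = x₂ + t • ((2 : ℂ) • E + y₀ + y₁)) (hy₀ : Q y₀ = y₀ + t • ((2 : ℂ) • S + x₁ + x₂))
    (hy₁ : Q y₁ = y₁ + t • ((2 : ℂ) • S + x₀ + x₂))
    (hy₂ : Q y₂ = y₂ + t • ((2 : ℂ) • S + x₀ + x₁)) :
    annihilator Q t x₀ = 0 := by
  have h1 : ((Q - 1) * (Q - 1) - t ^ 2 • 1 : Module.End ℂ M) x₀
      = (4 * t) • E + (4 * t ^ 2) • S + t ^ 2 • (x₀ + x₁ + x₂) := by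
    simp only [LinearMap.sub_apply, Module.End.mul_apply, LinearMap.smul_apply,
      Module.End.one_apply, map_add, map_smul, map_sub, hE, hx₀, hy₁, hy₂]
    module
  have h2 : ((Q - 1) * (Q - 1) - (4 * t ^ 2) • 1 : Module.End ℂ M)
      ((4 * t) • E + (4 * t ^ 2) • S + t ^ 2 • (x₀ + x₁ + x₂))
      = (16 * t - 4 * t ^ 3) • E + (16 * t ^ 2 - 4 * t ^ 4) • S := by
    simp only [LinearMap.sub_apply, Module.End.mul_apply, LinearMap.smul_apply,
      Module.End.one_apply, map_add, map_smul, map_sub, hE, hS, hx₀, hx₁, hx₂, hy₀, hy₁, hy₂]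
    module
  rw [annihilator, Module.End.mul_apply, Module.End.mul_apply, h1, h2]
  simp only [LinearMap.sub_apply, LinearMap.smul_apply, Module.End.one_apply, map_add, map_smul,
    hE, hS]
  module

theorem annihilator_apply_of_eigenvector {M : Type*} [AddCommGroup M] [Module ℂ M]
    {Q : Module.End ℂ M} {t μ : ℂ} {v : M} (hv : Q v = μ • v) :
    annihilator Q t v
      = ((μ - 3) * ((μ - 1) ^ 2 - 4 * t ^ 2) * ((μ - 1) ^ 2 - t ^ 2)) • v := by
  simp only [annihilator, LinearMap.sub_apply, Module.End.mul_apply, LinearMap.smul_apply,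
    Module.End.one_apply, map_sub, map_smul, hv]
  module

theorem annihilator_pairMomentSum_permVec (hq : 2 ≤ q) (σ : Fin 3 → Equiv.Perm (Fin 2)) :
    annihilator (pairMomentSum q).mulVecLin ((q : ℂ) / (q ^ 2 + 1)) (permVec q σ) = 0 := by
  have hE : ∀ p, (pairMomentSum q).mulVecLin (permVec q ![p, p, p])
    = (3 : ℂ) • permVec q ![p, p, p] := fun p => pairMomentSum_mulVec_permVec_of_const p
  have h0 : ∀ {p r}, p ≠ r → (pairMomentSum q).mulVecLin (permVec q ![r, p, p]) = _ :=
    fun h => pairMomentSum_mulVec_permVec_zero hq h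
  have h1 : ∀ {p r}, p ≠ r → (pairMomentSum q).mulVecLin (permVec q ![p, r, p]) = _ :=
    fun h => pairMomentSum_mulVec_permVec_one hq h
  have h2 : ∀ {p r}, p ≠ r → (pairMomentSum q).mulVecLin (permVec q ![p, p, r]) = _ :=
    fun h => pairMomentSum_mulVec_permVec_two hq h
  have hconst : ∀ p : Equiv.Perm (Fin 2), annihilator (pairMomentSum q).mulVecLin
      ((q : ℂ) / (q ^ 2 + 1)) (permVec q ![p, p, p]) = 0 := fun p => by
    rw [annihilator_apply_of_eigenvector (hE p)]
    simp
  obtain ⟨a, b, c, rfl⟩ : ∃ a b c, σ = ![a, b, c] :=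
    ⟨σ 0, σ 1, σ 2, by ext v : 1; fin_cases v <;> rfl⟩
  have hcases : ∀ a b c : Equiv.Perm (Fin 2),
      (a = b ∧ b = c) ∨ (a ≠ b ∧ b = c) ∨ (a = c ∧ a ≠ b) ∨ (a = b ∧ b ≠ c) := by decide
  rcases hcases a b c with ⟨rfl, rfl⟩ | ⟨h, rfl⟩ | ⟨rfl, h⟩ | ⟨rfl, h⟩
  · exact hconst _
  · exact annihilator_apply_eq_zero (hE _) (hE _) (h0 h.symm) (h1 h.symm) (h2 h.symm)
      (h0 h) (h1 h) (h2 h)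
  -- The vector under study must play `x₀`, so the sites are relabelled; `module` reorders the sums
  -- accordingly.
  · refine annihilator_apply_eq_zero (hE a) (hE b) (h1 h) (h0 h) ((h2 h).trans ?_)
      (h1 h.symm) (h0 h.symm) ((h2 h.symm).trans ?_) <;> module
  · refine annihilator_apply_eq_zero (hE a) (hE c) ((h2 h).trans ?_) ((h0 h).trans ?_)
      ((h1 h).trans ?_) ((h2 h.symm).trans ?_) ((h0 h.symm).trans ?_) ((h1 h.symm).trans ?_)
      <;> module

theorem eigenvalue_pairMomentSum (hq : 2 ≤ q) {μ : ℂ} {v : Copies 2 (Fin 3 → Fin q) → ℂ}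
    (hv0 : v ≠ 0) (hv : pairMomentSum q *ᵥ v = μ • v) :
    μ = 0 ∨ μ = 1 ∨ (μ - 3) * ((μ - 1) ^ 2 - 4 * ((q : ℂ) / (q ^ 2 + 1)) ^ 2) *
      ((μ - 1) ^ 2 - ((q : ℂ) / (q ^ 2 + 1)) ^ 2) = 0 := by
  by_contra! hμ
  have hmem := mem_span_permVec_of_pairMomentSum_mulVec hq hμ.1 hμ.2.1 hv
  have hle : Submodule.span ℂ (Set.range (permVec q : (Fin 3 → Equiv.Perm (Fin 2)) → _)) ≤
      LinearMap.ker (annihilator (pairMomentSum q).mulVecLin ((q : ℂ) / (q ^ 2 + 1))) := by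
    rw [Submodule.span_le]
    rintro _ ⟨σ, rfl⟩
    exact annihilator_pairMomentSum_permVec hq σ
  have hz := hle hmem
  rw [LinearMap.mem_ker, annihilator_apply_of_eigenvector (μ := μ) hv] at hz
  exact (smul_eq_zero.mp hz).elim hμ.2.2 hv0

/-- The component of `permVec q σ` at a basis index whose copies are paired by `ρ` only. -/
theorem permVec_apply_probe (hq : 2 ≤ q) (σ ρ : Fin 3 → Equiv.Perm (Fin 2)) :
    permVec q σ (fun a _ => ⟨a, by omega⟩, fun a v => ⟨(ρ v).symm a, by omega⟩)
      = if σ = ρ then 1 else 0 := by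
  simp only [permVec, siteProd, pairVec, Finset.prod_ite_zero, Finset.prod_const_one,
    Finset.mem_univ, true_imp_iff]
  refine if_congr ?_ rfl rfl
  rw [funext_iff]
  refine forall_congr' fun v => ?_
  simp only [siteAt, funext_iff, Function.comp_apply, Fin.mk.injEq, Fin.val_inj]
  rw [Equiv.ext_iff]
  exact forall_congr' fun a => by rw [Equiv.eq_symm_apply, eq_comm]

theorem exists_pairMomentSum_mulVec_eq_three_smul (hq : 2 ≤ q) :
    ∃ v ≠ 0, pairMomentSum q *ᵥ v = (3 : ℂ) • v := by
  refine ⟨permVec q ![1, 1, 1], fun h => ?_, pairMomentSum_mulVec_permVec_of_const 1⟩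
  have h1 := permVec_apply_probe hq ![1, 1, 1] ![1, 1, 1]
  rw [h] at h1
  simp at h1

theorem exists_pairMomentSum_mulVec_eq_subleading_smul (hq : 2 ≤ q) :
    ∃ v ≠ 0, pairMomentSum q *ᵥ v = (1 + 2 * ((q : ℂ) / (q ^ 2 + 1))) • v := by
  have hs : (1 : Equiv.Perm (Fin 2)) ≠ Equiv.swap 0 1 := by decide
  have hq1 : (q : ℂ) ^ 2 + 1 ≠ 0 := by exact_mod_cast (by positivity : q ^ 2 + 1 ≠ 0)
  have ht : 1 - (q : ℂ) / (q ^ 2 + 1) ≠ 0 := fun h => by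
    rw [sub_eq_zero, eq_comm, div_eq_one_iff_eq hq1] at h
    have : q = q ^ 2 + 1 := by exact_mod_cast h
    nlinarith
  set t := (q : ℂ) / (q ^ 2 + 1)
  -- Q maps the sum X of the six nonconstant vectors to (1 + 2t) X + 6t (E + S). Adding c (E + S)
  -- gives an eigenvector for 1 + 2t exactly when 6t + 3c = (1 + 2t) c.
  obtain ⟨c, hc⟩ : ∃ c : ℂ, 6 * t + 2 * c = 2 * t * c :=
    ⟨-(3 * t) / (1 - t), by field_simp; ring⟩
  have e := fun p => pairMomentSum_mulVec_permVec_of_const (q := q) p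
  generalize hτ : (Equiv.swap 0 1 : Equiv.Perm (Fin 2)) = τ at hs
  refine ⟨permVec q ![1, 1, τ] + permVec q ![1, τ, 1] + permVec q ![τ, 1, 1] +
    permVec q ![τ, τ, 1] + permVec q ![τ, 1, τ] + permVec q ![1, τ, τ] +
    c • (permVec q ![1, 1, 1] + permVec q ![τ, τ, τ]), fun h => ?_, ?_⟩
  -- This entry isolates the coefficient of `permVec q ![1, 1, τ]`, which is 1.
  · have h1 := congrFun h (fun a _ => ⟨a, by omega⟩,
      fun a v => ⟨((![1, 1, τ] : Fin 3 → Equiv.Perm (Fin 2)) v).symm a, by omega⟩)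
    simp only [Pi.add_apply, Pi.smul_apply, Pi.zero_apply, permVec_apply_probe hq] at h1
    simp [hs, hs.symm] at h1
  · simp only [Matrix.mulVec_add, Matrix.mulVec_smul, e,
      pairMomentSum_mulVec_permVec_zero hq hs, pairMomentSum_mulVec_permVec_zero hq hs.symm,
      pairMomentSum_mulVec_permVec_one hq hs, pairMomentSum_mulVec_permVec_one hq hs.symm,
      pairMomentSum_mulVec_permVec_two hq hs, pairMomentSum_mulVec_permVec_two hq hs.symm,
      show (q : ℂ) / (q ^ 2 + 1) = t from rfl]
    have hc' : c • (2 : ℂ) • (permVec q ![1, 1, 1] + permVec q ![τ, τ, τ])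
        = (2 * t * c - 6 * t) • (permVec q ![1, 1, 1] + permVec q ![τ, τ, τ]) := by
      rw [← hc]; module
    linear_combination (norm := module) hc'

theorem hamiltonian_complete_three (q k : ℕ) :
    hamiltonian (⊤ : SimpleGraph (Fin 3)) q k =
      localTerm q k {0, 1} + localTerm q k {1, 2} + localTerm q k {2, 0} := by
  have h : (⊤ : SimpleGraph (Fin 3)).edgeFinset = {s(0, 1), s(1, 2), s(2, 0)} := by decide
  rw [hamiltonian, h, Finset.sum_insert (by decide), Finset.sum_insert (by decide),
    Finset.sum_singleton, Sym2.toFinset_mk_eq, Sym2.toFinset_mk_eq, Sym2.toFinset_mk_eq, add_assoc]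

theorem hamiltonian_complete_three_mulVec (v : Copies 2 (Fin 3 → Fin q) → ℂ) :
    hamiltonian (⊤ : SimpleGraph (Fin 3)) q 2 *ᵥ v = (3 : ℂ) • v - pairMomentSum q *ᵥ v := by
  simp only [hamiltonian_complete_three, localTerm, pairMomentSum, Matrix.add_mulVec,
    Matrix.sub_mulVec, Matrix.one_mulVec]
  module

theorem isHermitian_localTerm {V : Type*} [Fintype V] [DecidableEq V] (k : ℕ) (S : Finset V) :
    (localTerm q k S).IsHermitian :=
  Matrix.isHermitian_one.sub (isHermitian_haarMoment S)

theorem mem_spectrum_hamiltonian_complete_three (r : ℝ) :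
    r ∈ spectrum ℝ (hamiltonian (⊤ : SimpleGraph (Fin 3)) q 2) ↔
      ∃ v ≠ 0, pairMomentSum q *ᵥ v = ((3 - r : ℝ) : ℂ) • v := by
  rw [mem_spectrum_real_iff]
  refine exists_congr fun v => and_congr_right fun _ => ?_
  rw [hamiltonian_complete_three_mulVec]
  push_cast
  rw [sub_smul, sub_eq_iff_eq_add, eq_sub_iff_add_eq, eq_comm, add_comm]

theorem hasSpectralGap_complete_three (hq : 2 ≤ q) :
    HasSpectralGap (hamiltonian (⊤ : SimpleGraph (Fin 3)) q 2)
      (2 * (1 - (q : ℝ) / ((q : ℝ) ^ 2 + 1))) := by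
  have hq' : (2 : ℝ) ≤ q := by exact_mod_cast hq
  have ht0 : 0 < (q : ℝ) / ((q : ℝ) ^ 2 + 1) := by positivity
  have ht1 : (q : ℝ) / ((q : ℝ) ^ 2 + 1) < 1 / 2 := by
    rw [div_lt_div_iff₀ (by positivity) (by norm_num)]
    nlinarith
  have hcast : (q : ℂ) / ((q : ℂ) ^ 2 + 1) = ((q / (q ^ 2 + 1) : ℝ) : ℂ) := by push_cast; rfl
  have hspec : ∀ r ∈ spectrum ℝ (hamiltonian (⊤ : SimpleGraph (Fin 3)) q 2),
      r = 0 ∨ 2 * (1 - (q : ℝ) / ((q : ℝ) ^ 2 + 1)) ≤ r := by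
    intro r hr
    obtain ⟨v, hv0, hv⟩ := (mem_spectrum_hamiltonian_complete_three r).mp hr
    have h := eigenvalue_pairMomentSum hq hv0 hv
    rw [hcast] at h
    generalize (q : ℝ) / ((q : ℝ) ^ 2 + 1) = t at h ht0 ht1 ⊢
    norm_cast at h
    -- Here μ = 3 - r, so the candidates for r are 3, 2, 0, 2 ± 2t and 2 ± t; all but 0 are at least
    -- 2 - 2t because t > 0.
    rcases h with h | h | h
    · right; linarith
    · right; linarith
    · rcases mul_eq_zero.mp h with h | h
      · rcases mul_eq_zero.mp h with h | h
        · left; linarith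
        · have h' : (3 - r - 1 - 2 * t) * (3 - r - 1 + 2 * t) = 0 := by linear_combination h
          right
          rcases mul_eq_zero.mp h' with h | h <;> linarith
      · have h' : (3 - r - 1 - t) * (3 - r - 1 + t) = 0 := by linear_combination h
        right
        rcases mul_eq_zero.mp h' with h | h <;> linarith
  have hzero : (0 : ℝ) ∈ spectrum ℝ (hamiltonian (⊤ : SimpleGraph (Fin 3)) q 2) := by
    rw [mem_spectrum_hamiltonian_complete_three]
    obtain ⟨v, hv0, hv⟩ := exists_pairMomentSum_mulVec_eq_three_smul hq
    exact ⟨v, hv0, by rw [hv]; norm_num⟩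
  have hgap : 2 * (1 - (q : ℝ) / ((q : ℝ) ^ 2 + 1)) ∈
      spectrum ℝ (hamiltonian (⊤ : SimpleGraph (Fin 3)) q 2) := by
    rw [mem_spectrum_hamiltonian_complete_three]
    obtain ⟨v, hv0, hv⟩ := exists_pairMomentSum_mulVec_eq_subleading_smul hq
    refine ⟨v, hv0, ?_⟩
    rw [hv]
    congr 1
    push_cast
    ring
  refine ⟨?_, 0, _, ⟨hzero, fun r hr => ?_⟩, ⟨⟨hgap, ?_⟩, fun r hr => ?_⟩, (sub_zero _).symm⟩
  · rw [hamiltonian_complete_three]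
    exact ((isHermitian_localTerm _ _).add (isHermitian_localTerm _ _)).add
      (isHermitian_localTerm _ _)
  · rcases hspec r hr with h | h <;> linarith
  · rw [Set.mem_singleton_iff]
    linarith
  · exact (hspec r hr.1).resolve_left hr.2

end ThreeSites

end RQC

theorem mainTheorem11 :
    (∀ q : ℕ, 2 ≤ q →
      RQC.hamiltonian (⊤ : SimpleGraph (Fin 3)) q 2 =
          RQC.localTerm q 2 {0, 1} + RQC.localTerm q 2 {1, 2} + RQC.localTerm q 2 {2, 0} ∧
        RQC.HasSpectralGap (RQC.hamiltonian (⊤ : SimpleGraph (Fin 3)) q 2)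
          (2 * (1 - (q : ℝ) / ((q : ℝ) ^ 2 + 1)))) ∧
    RQC.HasSpectralGap (RQC.hamiltonian (⊤ : SimpleGraph (Fin 3)) 2 2) (6 / 5) := by
  refine ⟨fun q hq => ⟨RQC.hamiltonian_complete_three q 2, RQC.hasSpectralGap_complete_three hq⟩, ?_⟩
  have h := RQC.hasSpectralGap_complete_three (q := 2) le_rfl
  norm_num at h
  exact h
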